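/- **Conventions.** Let $(\mathcal C,\mathbb E,\mathfrak s)$ be an extriangulated category in the sense of Nakaoka and Palu (on an additive category $\mathcal C$). A sequence $A\to B\to C$ that realizes some $\delta\in\mathbb E(C,A)$ is a *conflation* (and, with $\delta$, an *$\mathbb E$-triangle*); its first map is an *inflation*, its second map a *deflation*. A morphism is *compatible* if it is an isomorphism whenever it is both an inflation and a deflation. An object $P$ is *projective* if $0\to\mathcal C(P,A)\to\mathcal C(P,B)\to\mathcal C(P,C)\to0$ is exact for every conflation $A\to B\to C$; write $\mathcal P(\mathcal C)$ for the class of projective objects. A complex $(X_m,d_m)_{m\in\mathbb Z}$ is *exact* if there are conflations $K_{m+1}\xrightarrow{g_m}X_m\xrightarrow{f_m}K_m$ $(m\in\mathbb Z)$ with $d_m=g_{m-1}f_m$; it is $\mathcal C(-,\mathcal P(\mathcal C))$-exact (resp. $\mathcal C(\mathcal P(\mathcal C),-)$-exact) if these conflations can be chosen so that, for every projective $W$, the functor $\mathcal C(-,W)$ (resp. $\mathcal C(W,-)$) turns each of them into a short exact sequence of abelian groups. A *complete projective resolution* is a complex of projective objects that is both $\mathcal C(-,\mathcal P(\mathcal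 C))$-exact and $\mathcal C(\mathcal P(\mathcal C),-)$-exact. An object is *Gorenstein projective* if it is one of the objects $K_m$ in a choice of conflations witnessing that some complete projective resolution is $\mathcal C(-,\mathcal P(\mathcal C))$-exact. Let $n\ge1$. An object $N$ is a *Gorenstein $n$-syzygy object* if for some object $M$ there is an exact complex $$0\to N\to G_{n-1}\to\cdots\to G_1\to G_0\to M\to0$$ with all $G_i$ Gorenstein projective; that is, there are conflations $K_{i+1}\to G_i\to K_i$ for $0\le i<n$ with $K_0=M$, $K_n=N$ and all $G_i$ Gorenstein projective. A sequence $A\xrightarrow{f}B\xrightarrow{g}C$ is *right exact* if $f=h_2h_1$ for a compatible deflation $h_1\colon A\to K$ and a conflation $K\xrightarrow{h_2}B\xrightarrow{g}C$; it is *left exact* if $g=h_2h_1$ for a conflation $A\xrightarrow{f}B\xrightarrow{h_1}K$ and a compatible inflation $h_2\colon K\to C$. A sequence $A\xrightarrow{f}B\xrightarrow{g}C\xrightarrow{h}D$ is *right exact* (resp. *left exact*) if there are conflations $A\xrightarrow{f}B\xrightarrow{g_1}K$ and $K\xrightarrow{g_2}C\xrightarrow{h}D$ with $g=g_2g_1$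 and $g_1$ (resp. $g_2$) compatible. An additive functor between extriangulated categories is *exact* if it sends conflations to conflations, and *right exact* (resp. *left exact*) if it preserves compatible morphisms and right exact (resp. left exact) three-term sequences. A *recollement* $R(\mathcal A',\mathcal A,\mathcal A'')$ of extriangulated categories consists of exact functors $i_*\colon\mathcal A'\to\mathcal A$ and $j^*\colon\mathcal A\to\mathcal A''$, right exact functors $i^*\colon\mathcal A\to\mathcal A'$ and $j_!\colon\mathcal A''\to\mathcal A$, and left exact functors $i^!\colon\mathcal A\to\mathcal A'$ and $j_*\colon\mathcal A''\to\mathcal A$ such that - $(i^*,i_*,i^!)$ and $(j_!,j^*,j_*)$ are adjoint triples; - $i_*$, $j_!$ and $j_*$ are fully faithful; - the essential image of $i_*$ is the kernel of $j^*$; - for every $X\in\mathcal A$ there are an object $Y\in\mathcal A'$ and a left exact sequence $i_*i^!X\to X\to j_*j^*X\to i_*Y$ whose first two maps are the adjunction morphisms; - for every $X\in\mathcal A$ there are an object $Y'\in\mathcal A'$ and a right exact sequence $i_*Y'\to j_!j^*X\to X\to i_*i^*X$ whose last two maps are the adjunction morphisms. **Theorem.** Let $R(\mathcal A',\mathcal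 A,\mathcal A'')$ be a recollement of extriangulated categories, let $n\ge1$, and let $X$, $X'$, $X''$ be Gorenstein $n$-syzygy objects in $\mathcal A$, $\mathcal A'$, $\mathcal A''$ respectively. 1. If $j_*$ is exact, then $j^*X$ is a Gorenstein $n$-syzygy object in $\mathcal A''$. 2. If $i^*$ is exact, then $i^*X$ is a Gorenstein $n$-syzygy object in $\mathcal A'$. 3. If $i^!$ and $i^*$ are exact and $i^*$ is faithful, then $i_*X'$ is a Gorenstein $n$-syzygy object in $\mathcal A$. 4. If $j_!$ and $j_*$ are exact, then $j_!X''$ is a Gorenstein $n$-syzygy object in $\mathcal A$. -/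

import Mathlib

open CategoryTheory CategoryTheory.Limits Opposite

universe w w₁ w₂ w₃ v v₁ v₂ v₃ u u₁ u₂ u₃

namespace Extri

section Bifunctor

variable {C : Type u} [Category.{v} C] (E : Cᵒᵖ ⥤ C ⥤ AddCommGrpCat.{w})

/-- The group `E(Z, X)` of extensions with end term `Z` and first term `X`. -/
abbrev Extension (Z X : C) : Type w := (E.obj (op Z)).obj X

variable {E}

/-- `a_* δ`, the image of `δ ∈ E(Z, X)` in `E(Z, X')` under `a : X ⟶ X'`. -/
def push {Z X X' : C} (a : X ⟶ X') (δ : Extension E Z X) : Extension E Z X' :=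
  ((E.obj (op Z)).map a).hom δ

/-- `c^* δ`, the image of `δ ∈ E(Z, X)` in `E(Z', X)` under `c : Z' ⟶ Z`. -/
def pull {Z Z' X : C} (c : Z' ⟶ Z) (δ : Extension E Z X) : Extension E Z' X :=
  ((E.map c.op).app X).hom δ

/-- The direct sum `δ ⊕ δ' ∈ E(Z ⊕ Z', X ⊕ X')` of two extensions. It is the element with
components `δ, 0, 0, δ'` when the bifunctor `E` is additive. -/
noncomputable def directSum [Preadditive C] [HasBinaryBiproducts C] {Z X Z' X' : C}
    (δ : Extension E Z X) (δ' : Extension E Z' X') : Extension E (Z ⊞ Z') (X ⊞ X') :=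
  push biprod.inl (pull biprod.fst δ) + push biprod.inr (pull biprod.snd δ')

end Bifunctor

section Sequences

variable {C : Type u} [Category.{v} C]

/-- Sequences `X ⟶ Y ⟶ Z` with prescribed ends `X` and `Z`. -/
structure ThreeTerm (X Z : C) where
  /-- the middle term -/
  mid : C
  /-- the first morphism -/
  fst : X ⟶ mid
  /-- the second morphism -/
  snd : mid ⟶ Z

/-- Two sequences with the same ends are equivalent if there is an isomorphism of their middle
terms that is compatible with the morphisms. -/
instance ThreeTerm.setoid (X Z : C) : Setoid (ThreeTerm X Z) where
  r S T := ∃ b : S.mid ≅ T.mid, S.fst ≫ b.hom = T.fst ∧ b.hom ≫ T.snd = S.snd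
  iseqv :=
    { refl := fun S => ⟨Iso.refl _, by simp, by simp⟩
      symm := by
        rintro S T ⟨b, h₁, h₂⟩
        exact ⟨b.symm, by simp [← h₁], by simp [← h₂]⟩
      trans := by
        rintro S T U ⟨b, h₁, h₂⟩ ⟨c, h₃, h₄⟩
        exact ⟨b ≪≫ c, by simp [← h₃, ← h₁], by simp [h₄, h₂]⟩ }

/-- The equivalence class `[X ⟶ Y ⟶ Z]`. -/
def seqClass {X Y Z : C} (x : X ⟶ Y) (y : Y ⟶ Z) : Quotient (ThreeTerm.setoid X Z) :=
  Quotient.mk _ ⟨Y, x, y⟩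

end Sequences

/-- An extriangulated structure `(E, s)` on an additive category `C` (Nakaoka--Palu). -/
class Extriangulated (C : Type u) [Category.{v} C] [Preadditive C] [HasZeroObject C] [HasBinaryBiproducts C] where
  /-- the bifunctor of extensions -/
  E : Cᵒᵖ ⥤ C ⥤ AddCommGrpCat.{w}
  additive_obj : ∀ Z : Cᵒᵖ, (E.obj Z).Additive
  additive_flip_obj : ∀ X : C, (E.flip.obj X).Additive
  /-- the realization -/
  s : ∀ {Z X : C}, Extension E Z X → Quotient (ThreeTerm.setoid X Z)
  /-- A morphism of extensions lifts to a morphism of realizing sequences. -/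
  exists_lift : ∀ {X Y Z X' Y' Z' : C} {x : X ⟶ Y} {y : Y ⟶ Z} {x' : X' ⟶ Y'} {y' : Y' ⟶ Z'}
    {δ : Extension E Z X} {δ' : Extension E Z' X'},
    s δ = seqClass x y → s δ' = seqClass x' y' →
    ∀ (a : X ⟶ X') (c : Z ⟶ Z'), push a δ = pull c δ' →
      ∃ b : Y ⟶ Y', x ≫ b = a ≫ x' ∧ b ≫ y' = y ≫ c
  /-- The split extension is realized by the split sequence. -/
  s_zero : ∀ Z X : C, s (0 : Extension E Z X) =
    seqClass (biprod.inl : X ⟶ X ⊞ Z) (biprod.snd : X ⊞ Z ⟶ Z)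
  s_directSum : ∀ {X Y Z X' Y' Z' : C} {x : X ⟶ Y} {y : Y ⟶ Z} {x' : X' ⟶ Y'} {y' : Y' ⟶ Z'}
    {δ : Extension E Z X} {δ' : Extension E Z' X'},
    s δ = seqClass x y → s δ' = seqClass x' y' →
      s (directSum δ δ') = seqClass (biprod.map x x') (biprod.map y y')
  /-- (ET3) -/
  et3 : ∀ {X Y Z X' Y' Z' : C} {x : X ⟶ Y} {y : Y ⟶ Z} {x' : X' ⟶ Y'} {y' : Y' ⟶ Z'}
    {δ : Extension E Z X} {δ' : Extension E Z' X'},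
    s δ = seqClass x y → s δ' = seqClass x' y' →
    ∀ (a : X ⟶ X') (b : Y ⟶ Y'), x ≫ b = a ≫ x' →
      ∃ c : Z ⟶ Z', push a δ = pull c δ' ∧ b ≫ y' = y ≫ c
  /-- (ET3) for the opposite category -/
  et3_op : ∀ {X Y Z X' Y' Z' : C} {x : X ⟶ Y} {y : Y ⟶ Z} {x' : X' ⟶ Y'} {y' : Y' ⟶ Z'}
    {δ : Extension E Z X} {δ' : Extension E Z' X'},
    s δ = seqClass x y → s δ' = seqClass x' y' →
    ∀ (b : Y ⟶ Y') (c : Z ⟶ Z'), b ≫ y' = y ≫ c →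
      ∃ a : X ⟶ X', push a δ = pull c δ' ∧ x ≫ b = a ≫ x'
  /-- (ET4) -/
  et4 : ∀ {A B D M F : C} {f : A ⟶ B} {f' : B ⟶ D} {g : B ⟶ M} {g' : M ⟶ F}
    {δ : Extension E D A} {δ' : Extension E F B},
    s δ = seqClass f f' → s δ' = seqClass g g' →
    ∃ (N : C) (d : D ⟶ N) (e : N ⟶ F) (h' : M ⟶ N) (δ'' : Extension E N A),
      s δ'' = seqClass (f ≫ g) h' ∧ g ≫ h' = f' ≫ d ∧ h' ≫ e = g' ∧
      s (push f' δ') = seqClass d e ∧ pull d δ'' = δ ∧ push f δ'' = pull e δ'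
  /-- (ET4) for the opposite category -/
  et4_op : ∀ {D A B F M : C} {f' : D ⟶ A} {f : A ⟶ B} {g' : F ⟶ B} {g : B ⟶ M}
    {δ : Extension E B D} {δ' : Extension E M F},
    s δ = seqClass f' f → s δ' = seqClass g' g →
    ∃ (N : C) (d : D ⟶ N) (e : N ⟶ F) (h' : N ⟶ A) (δ'' : Extension E M N),
      s δ'' = seqClass h' (f ≫ g) ∧ h' ≫ f = e ≫ g' ∧ d ≫ h' = f' ∧
      s (pull g' δ) = seqClass d e ∧ push e δ'' = δ' ∧ push d δ = pull g δ''

section Objects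

variable {C : Type u} [Category.{v} C] [Preadditive C] [HasZeroObject C] [HasBinaryBiproducts C]
  [Extriangulated.{w} C]

/-- `X ⟶ Y ⟶ Z` is a conflation: it realizes some extension, that is, it is part of an
`E`-triangle. -/
def IsConflation {X Y Z : C} (x : X ⟶ Y) (y : Y ⟶ Z) : Prop :=
  ∃ δ : Extension (Extriangulated.E (C := C)) Z X, Extriangulated.s δ = seqClass x y

/-- Inflations are the first morphisms of conflations. -/
def IsInflation {X Y : C} (x : X ⟶ Y) : Prop :=
  ∃ (Z : C) (y : Y ⟶ Z), IsConflation x y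

/-- Deflations are the second morphisms of conflations. -/
def IsDeflation {Y Z : C} (y : Y ⟶ Z) : Prop :=
  ∃ (X : C) (x : X ⟶ Y), IsConflation x y

/-- The sequence `0 ⟶ C(W, X) ⟶ C(W, Y) ⟶ C(W, Z) ⟶ 0` induced by `x` and `y` is exact. -/
def HomFromExact (W : C) {X Y Z : C} (x : X ⟶ Y) (y : Y ⟶ Z) : Prop :=
  Function.Injective (fun a : W ⟶ X => a ≫ x) ∧
  Function.Exact (fun a : W ⟶ X => a ≫ x) (fun b : W ⟶ Y => b ≫ y) ∧
  Function.Surjective (fun b : W ⟶ Y => b ≫ y)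

/-- The sequence `0 ⟶ C(Z, W) ⟶ C(Y, W) ⟶ C(X, W) ⟶ 0` induced by `x` and `y` is exact. -/
def HomToExact (W : C) {X Y Z : C} (x : X ⟶ Y) (y : Y ⟶ Z) : Prop :=
  Function.Injective (fun c : Z ⟶ W => y ≫ c) ∧
  Function.Exact (fun c : Z ⟶ W => y ≫ c) (fun b : Y ⟶ W => x ≫ b) ∧
  Function.Surjective (fun b : Y ⟶ W => x ≫ b)

/-- Projective objects. -/
def IsProj (P : C) : Prop :=
  ∀ {X Y Z : C} (x : X ⟶ Y) (y : Y ⟶ Z), IsConflation x y → HomFromExact P x y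

/-- A way to splice an unbounded complex `X` from conflations `K (n+1) ⟶ X n ⟶ K n`. -/
structure ExactDecomposition (X : ChainComplex C ℤ) where
  /-- the end terms of the conflations -/
  K : ℤ → C
  /-- the inflations -/
  g : ∀ n, K (n + 1) ⟶ X.X n
  /-- the deflations -/
  f : ∀ n, X.X n ⟶ K n
  conflation : ∀ n, IsConflation (g n) (f n)
  d_eq : ∀ n, X.d (n + 1) n = f (n + 1) ≫ g n

/-- The conflations of the decomposition stay exact under `C(-, W)` for all `W` in the class. -/
def ExactDecomposition.HomToExactFor {X : ChainComplex C ℤ} (D : ExactDecomposition X)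
    (𝒲 : C → Prop) : Prop :=
  ∀ W, 𝒲 W → ∀ n, HomToExact W (D.g n) (D.f n)

/-- The conflations of the decomposition stay exact under `C(W, -)` for all `W` in the class. -/
def ExactDecomposition.HomFromExactFor {X : ChainComplex C ℤ} (D : ExactDecomposition X)
    (𝒲 : C → Prop) : Prop :=
  ∀ W, 𝒲 W → ∀ n, HomFromExact W (D.g n) (D.f n)

/-- Complete projective resolutions: complexes of projective objects that are both
`C(-, Proj)`-exact and `C(Proj, -)`-exact. -/
def IsCompleteProjectiveResolution (P : ChainComplex C ℤ) : Prop :=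
  (∀ n, IsProj (P.X n)) ∧
  (∃ D : ExactDecomposition P, D.HomToExactFor IsProj) ∧
  (∃ D : ExactDecomposition P, D.HomFromExactFor IsProj)

/-- Gorenstein projective objects: the objects `K n` in the `C(-, Proj)`-exact conflations
`K (n+1) ⟶ P n ⟶ K n` of a complete projective resolution `P`. -/
def IsGorensteinProjective (G : C) : Prop :=
  ∃ P : ChainComplex C ℤ, IsCompleteProjectiveResolution P ∧
    ∃ D : ExactDecomposition P, D.HomToExactFor IsProj ∧ ∃ n, Nonempty (D.K n ≅ G)

/-- An exact complex `0 ⟶ N ⟶ G (n-1) ⟶ ⋯ ⟶ G 0 ⟶ M ⟶ 0`: it is spliced from conflations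
`K (i+1) ⟶ G i ⟶ K i` for `i < n`, where `K 0 = M` and `K n = N`. Its inner differentials are
the composites `G (i+1) ⟶ K (i+1) ⟶ G i`. The values of the families outside the displayed range
play no role. -/
structure FiniteExactComplex (n : ℕ) (N M : C) where
  /-- the inner terms of the complex -/
  G : ℕ → C
  /-- the end terms of the conflations -/
  K : ℕ → C
  /-- the inflations -/
  g : ∀ i, K (i + 1) ⟶ G i
  /-- the deflations -/
  f : ∀ i, G i ⟶ K i
  conflation : ∀ i, i < n → IsConflation (g i) (f i)
  /-- the right end of the complex -/
  isoRight : K 0 ≅ M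
  /-- the left end of the complex -/
  isoLeft : K n ≅ N

/-- `N` is a Gorenstein `n`-syzygy object of `M`. -/
def IsGorensteinSyzygyOf (n : ℕ) (N M : C) : Prop :=
  ∃ X : FiniteExactComplex n N M, ∀ i, i < n → IsGorensteinProjective (X.G i)

/-- `N` is a Gorenstein `n`-syzygy object (of some object). -/
def IsGorensteinSyzygy (n : ℕ) (N : C) : Prop :=
  ∃ M : C, IsGorensteinSyzygyOf n N M

/-- A morphism is compatible if it is an isomorphism as soon as it is both an inflation and a
deflation. -/
def IsCompatible {X Y : C} (f : X ⟶ Y) : Prop :=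
  IsInflation f → IsDeflation f → IsIso f

/-- Right exact sequences `X ⟶ Y ⟶ Z`. -/
def IsRightExactSeq {X Y Z : C} (f : X ⟶ Y) (g : Y ⟶ Z) : Prop :=
  ∃ (K : C) (h₁ : X ⟶ K) (h₂ : K ⟶ Y),
    IsConflation h₂ g ∧ IsDeflation h₁ ∧ IsCompatible h₁ ∧ f = h₁ ≫ h₂

/-- Left exact sequences `X ⟶ Y ⟶ Z`. -/
def IsLeftExactSeq {X Y Z : C} (f : X ⟶ Y) (g : Y ⟶ Z) : Prop :=
  ∃ (K : C) (h₁ : Y ⟶ K) (h₂ : K ⟶ Z),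
    IsConflation f h₁ ∧ IsInflation h₂ ∧ IsCompatible h₂ ∧ g = h₁ ≫ h₂

/-- Right exact four-term `E`-triangle sequences `A ⟶ B ⟶ M ⟶ D`. -/
def IsRightExactSeq₄ {A B M D : C} (f : A ⟶ B) (g : B ⟶ M) (h : M ⟶ D) : Prop :=
  ∃ (K : C) (g₁ : B ⟶ K) (g₂ : K ⟶ M),
    IsConflation f g₁ ∧ IsConflation g₂ h ∧ g = g₁ ≫ g₂ ∧ IsCompatible g₁

/-- Left exact four-term `E`-triangle sequences `A ⟶ B ⟶ M ⟶ D`. -/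
def IsLeftExactSeq₄ {A B M D : C} (f : A ⟶ B) (g : B ⟶ M) (h : M ⟶ D) : Prop :=
  ∃ (K : C) (g₁ : B ⟶ K) (g₂ : K ⟶ M),
    IsConflation f g₁ ∧ IsConflation g₂ h ∧ g = g₁ ≫ g₂ ∧ IsCompatible g₂

end Objects

section Functors

variable {C : Type u₁} [Category.{v₁} C] [Preadditive C] [HasZeroObject C] [HasBinaryBiproducts C]
  [Extriangulated.{w₁} C]
  {D : Type u₂} [Category.{v₂} D] [Preadditive D] [HasZeroObject D] [HasBinaryBiproducts D]
  [Extriangulated.{w₂} D]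

/-- Exact functors: additive functors that preserve `E`-triangles. -/
structure IsExactFunctor (F : C ⥤ D) : Prop where
  additive : F.Additive
  map_conflation : ∀ {X Y Z : C} (x : X ⟶ Y) (y : Y ⟶ Z),
    IsConflation x y → IsConflation (F.map x) (F.map y)

/-- Right exact functors: additive functors that preserve compatible morphisms and right exact
sequences. -/
structure IsRightExactFunctor (F : C ⥤ D) : Prop where
  additive : F.Additive
  map_compatible : ∀ {X Y : C} (f : X ⟶ Y), IsCompatible f → IsCompatible (F.map f)
  map_rightExact : ∀ {X Y Z : C} (x : X ⟶ Y) (y : Y ⟶ Z),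
    IsRightExactSeq x y → IsRightExactSeq (F.map x) (F.map y)

/-- Left exact functors: additive functors that preserve compatible morphisms and left exact
sequences. -/
structure IsLeftExactFunctor (F : C ⥤ D) : Prop where
  additive : F.Additive
  map_compatible : ∀ {X Y : C} (f : X ⟶ Y), IsCompatible f → IsCompatible (F.map f)
  map_leftExact : ∀ {X Y Z : C} (x : X ⟶ Y) (y : Y ⟶ Z),
    IsLeftExactSeq x y → IsLeftExactSeq (F.map x) (F.map y)

end Functors

/-- A recollement of the extriangulated category `A` relative to the extriangulated categories
`A'` and `A''`. -/
structure Recollement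
    (A' : Type u₁) [Category.{v₁} A'] [Preadditive A'] [HasZeroObject A'] [HasBinaryBiproducts A']
    [Extriangulated.{w₁} A']
    (A : Type u₂) [Category.{v₂} A] [Preadditive A] [HasZeroObject A] [HasBinaryBiproducts A]
    [Extriangulated.{w₂} A]
    (A'' : Type u₃) [Category.{v₃} A''] [Preadditive A''] [HasZeroObject A''] [HasBinaryBiproducts A'']
    [Extriangulated.{w₃} A''] where
  /-- `i^*` -/
  iUpperStar : A ⥤ A'
  /-- `i_*` -/
  iLowerStar : A' ⥤ A
  /-- `i^!` -/
  iUpperShriek : A ⥤ A'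
  /-- `j_!` -/
  jLowerShriek : A'' ⥤ A
  /-- `j^*` -/
  jUpperStar : A ⥤ A''
  /-- `j_*` -/
  jLowerStar : A'' ⥤ A
  iLowerStar_exact : IsExactFunctor iLowerStar
  jUpperStar_exact : IsExactFunctor jUpperStar
  iUpperStar_rightExact : IsRightExactFunctor iUpperStar
  jLowerShriek_rightExact : IsRightExactFunctor jLowerShriek
  iUpperShriek_leftExact : IsLeftExactFunctor iUpperShriek
  jLowerStar_leftExact : IsLeftExactFunctor jLowerStar
  /-- `i^* ⊣ i_*` -/
  iAdj₁ : iUpperStar ⊣ iLowerStar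
  /-- `i_* ⊣ i^!` -/
  iAdj₂ : iLowerStar ⊣ iUpperShriek
  /-- `j_! ⊣ j^*` -/
  jAdj₁ : jLowerShriek ⊣ jUpperStar
  /-- `j^* ⊣ j_*` -/
  jAdj₂ : jUpperStar ⊣ jLowerStar
  iLowerStar_full : iLowerStar.Full
  iLowerStar_faithful : iLowerStar.Faithful
  jLowerShriek_full : jLowerShriek.Full
  jLowerShriek_faithful : jLowerShriek.Faithful
  jLowerStar_full : jLowerStar.Full
  jLowerStar_faithful : jLowerStar.Faithful
  /-- The essential image of `i_*` is the kernel of `j^*`. -/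
  essImage_iff : ∀ X : A, iLowerStar.essImage X ↔ IsZero (jUpperStar.obj X)
  /-- `i_* i^! X ⟶ X ⟶ j_* j^* X ⟶ i_* Y` is left exact for some `Y`. -/
  leftExact_seq : ∀ X : A, ∃ (Y : A') (h : jLowerStar.obj (jUpperStar.obj X) ⟶ iLowerStar.obj Y),
    IsLeftExactSeq₄ (iAdj₂.counit.app X) (jAdj₂.unit.app X) h
  /-- `i_* Y ⟶ j_! j^* X ⟶ X ⟶ i_* i^* X` is right exact for some `Y`. -/
  rightExact_seq : ∀ X : A,
    ∃ (Y : A') (h : iLowerStar.obj Y ⟶ jLowerShriek.obj (jUpperStar.obj X)),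
      IsRightExactSeq₄ h (jAdj₁.counit.app X) (iAdj₁.unit.app X)

end Extri

/-! A Gorenstein `n`-syzygy object is already an `n`-syzygy object of a complex of projectives,
possibly with another right end (`isGorensteinSyzygy_iff_isProj`). An exact functor with an exact
right adjoint preserves conflations and projectives (`IsProj.map_of_adjunction`), hence such
syzygies. The four claims apply this to the adjoint pairs $(j^*,j_*)$, $(i^*,i_*)$, $(i_*,i^!)$ and
$(j_!,j^*)$.

To replace the terms, take $N\to G\to K$ and a conflation $G\to P\to G'$ with $P$ projective. The
octahedral axiom gives $N\to P\to L$ and $K\to L\to G'$. Pushing $L$ out along the next inflation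
$K\to G_0$ turns $G_0$ into an extension $H$ of $G'$ by $G_0$, and the argument continues from $L\to
H$ (`IsSyzygy.isProj`). This needs a class closed under extensions that contains the Gorenstein
projectives. The class `InCoresolving` keeps only what the argument uses, embeddings into
projectives and vanishing extensions, and is defined coinductively; `InCoresolving.of_conflation`
shows that it is closed. -/

namespace Extri

/-! ### Functoriality of extensions and equivalence of sequences. -/

section Basic

variable {C : Type u} [Category.{v} C] {E : Cᵒᵖ ⥤ C ⥤ AddCommGrpCat.{w}}

@[simp] lemma push_id {Z X : C} (δ : Extension E Z X) : push (𝟙 X) δ = δ := by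
  simp [push]

@[simp] lemma pull_id {Z X : C} (δ : Extension E Z X) : pull (𝟙 Z) δ = δ := by
  simp [pull]

lemma push_comp {Z X X' X'' : C} (a : X ⟶ X') (a' : X' ⟶ X'') (δ : Extension E Z X) :
    push (a ≫ a') δ = push a' (push a δ) := by
  simp [push]

lemma pull_comp {Z Z' Z'' X : C} (c : Z' ⟶ Z) (c' : Z'' ⟶ Z') (δ : Extension E Z X) :
    pull (c' ≫ c) δ = pull c' (pull c δ) := by
  simp [pull]

lemma push_pull {Z Z' X X' : C} (a : X ⟶ X') (c : Z' ⟶ Z) (δ : Extension E Z X) :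
    push a (pull c δ) = pull c (push a δ) := by
  have := ConcreteCategory.congr_hom ((E.map c.op).naturality a) δ
  simp [push, pull]

@[simp] lemma push_map_zero {Z X X' : C} (a : X ⟶ X') :
    push a (0 : Extension E Z X) = 0 := map_zero _

@[simp] lemma pull_map_zero {Z Z' X : C} (c : Z' ⟶ Z) :
    pull c (0 : Extension E Z X) = 0 := map_zero _

lemma pull_add {Z Z' X : C} (c : Z' ⟶ Z) (δ ε : Extension E Z X) :
    pull c (δ + ε) = pull c δ + pull c ε := map_add _ _ _

lemma seqClass_eq_iff {X Y Y' Z : C} {x : X ⟶ Y} {y : Y ⟶ Z} {x' : X ⟶ Y'} {y' : Y' ⟶ Z} :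
    seqClass x y = seqClass x' y' ↔ ∃ b : Y ≅ Y', x ≫ b.hom = x' ∧ b.hom ≫ y' = y :=
  Quotient.eq (r := ThreeTerm.setoid X Z)

end Basic

/-! ### Basic consequences of the axioms. -/

section Structure

variable {C : Type u} [Category.{v} C] [Preadditive C] [HasZeroObject C] [HasBinaryBiproducts C]
  [Extriangulated.{w} C]

local notation "𝔼" => Extension (Extriangulated.E (C := C))

lemma zero_pull {Z Z' X : C} (δ : 𝔼 Z X) : pull (0 : Z' ⟶ Z) δ = 0 := by
  have := Extriangulated.additive_flip_obj (C := C) X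
  have h : (Extriangulated.E.flip.obj X).map (0 : op Z ⟶ op Z') = 0 := Functor.map_zero _ _ _
  exact ConcreteCategory.congr_hom h δ

lemma exists_realization {Z X : C} (δ : 𝔼 Z X) :
    ∃ (Y : C) (x : X ⟶ Y) (y : Y ⟶ Z), Extriangulated.s δ = seqClass x y := by
  obtain ⟨T, hT⟩ := Quotient.exists_rep (Extriangulated.s δ)
  exact ⟨T.mid, T.fst, T.snd, hT.symm⟩

-- Comparing a conflation with this trivial one through (ET3), its dual or the lifting axiom turns
-- those axioms into statements about a single morphism.
open ZeroObject in
lemma s_zero_left (Y : C) :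
    Extriangulated.s (0 : 𝔼 Y 0) = seqClass (0 : (0 : C) ⟶ Y) (𝟙 Y) := by
  rw [Extriangulated.s_zero, seqClass_eq_iff]
  refine ⟨⟨biprod.snd, biprod.inr, ?_, by simp⟩, by simp, by simp⟩
  apply biprod.hom_ext'
  · exact (isZero_zero C).eq_of_src _ _
  · simp

open ZeroObject in
lemma s_zero_right (Y : C) :
    Extriangulated.s (0 : 𝔼 0 Y) = seqClass (𝟙 Y) (0 : Y ⟶ (0 : C)) := by
  rw [Extriangulated.s_zero, seqClass_eq_iff]
  refine ⟨⟨biprod.fst, biprod.inl, ?_, by simp⟩, by simp, (isZero_zero C).eq_of_tgt _ _⟩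
  apply biprod.hom_ext
  · simp
  · exact (isZero_zero C).eq_of_tgt _ _

lemma pull_snd_eq_zero {X Y Z : C} {x : X ⟶ Y} {y : Y ⟶ Z} {δ : 𝔼 Z X}
    (h : Extriangulated.s δ = seqClass x y) : pull y δ = 0 := by
  obtain ⟨a, ha, -⟩ := Extriangulated.et3_op (s_zero_left Y) h (𝟙 Y) y (by simp)
  rw [← ha, push_map_zero]

lemma push_fst_eq_zero {X Y Z : C} {x : X ⟶ Y} {y : Y ⟶ Z} {δ : 𝔼 Z X}
    (h : Extriangulated.s δ = seqClass x y) : push x δ = 0 := by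
  obtain ⟨c, hc, -⟩ := Extriangulated.et3 h (s_zero_right Y) x (𝟙 Y) (by simp)
  rw [hc, pull_map_zero]

/-- A morphism out of the middle term that vanishes on the first term factors through the
deflation. -/
lemma exists_desc {X Y Z W : C} {x : X ⟶ Y} {y : Y ⟶ Z} {δ : 𝔼 Z X}
    (h : Extriangulated.s δ = seqClass x y) (m : Y ⟶ W) (hm : x ≫ m = 0) :
    ∃ c : Z ⟶ W, y ≫ c = m := by
  obtain ⟨c, -, hc⟩ := Extriangulated.et3 h (s_zero_left W) 0 m (by simpa using hm)
  exact ⟨c, by simpa using hc.symm⟩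

/-- An endomorphism of a conflation that is the identity on both ends is an isomorphism. -/
lemma isIso_of_end {X Y Z : C} {x : X ⟶ Y} {y : Y ⟶ Z} {δ : 𝔼 Z X}
    (h : Extriangulated.s δ = seqClass x y) (b : Y ⟶ Y) (h₁ : x ≫ b = x) (h₂ : b ≫ y = y) :
    IsIso b := by
  obtain ⟨c, hc⟩ := exists_desc h (b - 𝟙 Y) (by simp [h₁])
  have hb : b = 𝟙 Y + y ≫ c := by rw [hc]; abel
  have hy : y ≫ c ≫ y = 0 := by
    rw [← Category.assoc, hc]; simp [h₂]
  -- `b` differs from the identity by `y ≫ c`, which squares to zero, so the inverse is `𝟙 Y - y ≫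
  -- c`.
  have hn : y ≫ c ≫ y ≫ c = 0 := by
    have := congrArg (· ≫ c) hy
    simpa using this
  refine ⟨𝟙 Y - y ≫ c, ?_, ?_⟩ <;> rw [hb] <;> simp [hn]

/-- Realizations are transported along isomorphisms of the end terms. -/
lemma s_eq_of_iso {X Y Z X' Z' : C} {x : X ⟶ Y} {y : Y ⟶ Z} {δ : 𝔼 Z X}
    (h : Extriangulated.s δ = seqClass x y) (a : X ≅ X') (c : Z ≅ Z') :
    Extriangulated.s (pull c.inv (push a.hom δ)) = seqClass (a.inv ≫ x) (y ≫ c.hom) := by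
  obtain ⟨Y', x', y', h'⟩ := exists_realization (pull c.inv (push a.hom δ))
  have e₁ : push a.hom δ = pull c.hom (pull c.inv (push a.hom δ)) := by
    rw [← pull_comp, c.hom_inv_id, pull_id]
  have e₂ : push a.inv (pull c.inv (push a.hom δ)) = pull c.inv δ := by
    rw [push_pull, ← push_comp, a.hom_inv_id, push_id]
  obtain ⟨b, hb₁, hb₂⟩ := Extriangulated.exists_lift h h' a.hom c.hom e₁
  obtain ⟨b', hb'₁, hb'₂⟩ := Extriangulated.exists_lift h' h a.inv c.inv e₂
  -- The lifts need not be mutually inverse, but both composites fix the ends and are therefore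
  -- invertible.
  have i₁ : IsIso (b ≫ b') := isIso_of_end h _
    (by rw [← Category.assoc, hb₁, Category.assoc, hb'₁]; simp)
    (by rw [Category.assoc, hb'₂, ← Category.assoc, hb₂]; simp)
  have i₂ : IsIso (b' ≫ b) := isIso_of_end h' _
    (by rw [← Category.assoc, hb'₁, Category.assoc, hb₁]; simp)
    (by rw [Category.assoc, hb₂, ← Category.assoc, hb'₂]; simp)
  have m : Mono b := mono_of_mono b b'
  have sp : IsSplitEpi b := ⟨⟨inv (b' ≫ b) ≫ b', by simp⟩⟩
  have : IsIso b := isIso_of_mono_of_isSplitEpi b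
  rw [h', eq_comm, seqClass_eq_iff]
  exact ⟨asIso b, by simp [hb₁], by simp [hb₂]⟩

/-! ### Conflations on the level of objects: octahedra and push-outs. -/

variable (C) in
/-- `HasConflation X Y Z`: there is a conflation `X ⟶ Y ⟶ Z`. -/
def HasConflation (X Y Z : C) : Prop :=
  ∃ (x : X ⟶ Y) (y : Y ⟶ Z), IsConflation x y

lemma HasConflation.of_iso {X Y Z X' Y' Z' : C} (h : HasConflation C X Y Z) (a : X ≅ X')
    (b : Y ≅ Y') (c : Z ≅ Z') : HasConflation C X' Y' Z' := by
  obtain ⟨x, y, δ, h⟩ := h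
  refine ⟨a.inv ≫ x ≫ b.hom, b.inv ≫ y ≫ c.hom, _, (s_eq_of_iso h a c).trans ?_⟩
  rw [seqClass_eq_iff]
  exact ⟨b, by simp, by simp⟩

-- Add the trivial conflation `W ⟶ W ⟶ 0` to the given one.
open ZeroObject in
lemma HasConflation.biprod_map {X Y Z : C} (W : C) (h : HasConflation C X Y Z) :
    HasConflation C (W ⊞ X) (W ⊞ Y) Z := by
  obtain ⟨x, y, δ, h⟩ := h
  have h' : HasConflation C (W ⊞ X) (W ⊞ Y) ((0 : C) ⊞ Z) :=
    ⟨_, _, _, Extriangulated.s_directSum (s_zero_right W) h⟩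
  refine h'.of_iso (Iso.refl _) (Iso.refl _) ⟨biprod.snd, biprod.inr, ?_, by simp⟩
  apply biprod.hom_ext'
  · exact (isZero_zero C).eq_of_src _ _
  · simp

/-- The octahedral axiom on the level of objects. -/
lemma HasConflation.octahedron {A B D M F : C} (h : HasConflation C A B D)
    (h' : HasConflation C B M F) :
    ∃ N, HasConflation C A M N ∧ HasConflation C D N F := by
  obtain ⟨f, f', δ, h⟩ := h
  obtain ⟨g, g', δ', h'⟩ := h'
  obtain ⟨N, d, e, k, δ'', h₁, -, -, h₂, -⟩ := Extriangulated.et4 h h'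
  exact ⟨N, ⟨_, _, _, h₁⟩, ⟨_, _, _, h₂⟩⟩

/-- Given an extension `μ` of `Z` by `K` and a conflation `Z₁ ⟶ Z ⟶ Z₂`, the middle term of the
pulled back extension of `Z₁` embeds in that of `μ` with cokernel `Z₂`. -/
lemma hasConflation_of_pull {K H L Z Z₁ Z₂ : C} {k : K ⟶ H} {p : H ⟶ Z} {μ : 𝔼 Z K}
    (hμ : Extriangulated.s μ = seqClass k p) {z₁ : Z₁ ⟶ Z} {z₂ : Z ⟶ Z₂}
    (hz : IsConflation z₁ z₂) {l : K ⟶ L} {q : L ⟶ Z₁}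
    (hL : Extriangulated.s (pull z₁ μ) = seqClass l q) : HasConflation C L H Z₂ := by
  obtain ⟨ζ, hζ⟩ := hz
  obtain ⟨N, d, e, h', δ'', h₁, -, -, h₂, -⟩ := Extriangulated.et4_op hμ hζ
  obtain ⟨b, -⟩ := seqClass_eq_iff.1 (h₂.symm.trans hL)
  exact HasConflation.of_iso ⟨_, _, _, h₁⟩ b (Iso.refl _) (Iso.refl _)

lemma isConflation_inl_snd (X Z : C) :
    IsConflation (biprod.inl : X ⟶ X ⊞ Z) (biprod.snd : X ⊞ Z ⟶ Z) :=
  ⟨0, Extriangulated.s_zero Z X⟩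

lemma isConflation_inr_fst (X Z : C) :
    IsConflation (biprod.inr : Z ⟶ X ⊞ Z) (biprod.fst : X ⊞ Z ⟶ X) := by
  refine ⟨0, ?_⟩
  rw [Extriangulated.s_zero, seqClass_eq_iff]
  exact ⟨biprod.braiding Z X, by ext <;> simp, by simp⟩

/-- The push-out of two inflations with the same source. -/
lemma HasConflation.pushout {K L G Z₁ Z₂ : C} (h₁ : HasConflation C K L Z₁)
    (h₂ : HasConflation C K G Z₂) :
    ∃ H, HasConflation C L H Z₂ ∧ HasConflation C G H Z₁ := by
  obtain ⟨l, q, δ₁, h₁⟩ := h₁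
  obtain ⟨g, r, δ₂, h₂⟩ := h₂
  -- The push-out is the middle term of the extension of `Z₁ ⊞ Z₂` that restricts to `δ₁` and `δ₂`
  -- on the two summands.
  let μ : 𝔼 (Z₁ ⊞ Z₂) K := pull biprod.fst δ₁ + pull biprod.snd δ₂
  obtain ⟨H, k, p, hμ⟩ := exists_realization μ
  have e₁ : pull biprod.inl μ = δ₁ := by
    simp [μ, pull_add, ← pull_comp, zero_pull]
  have e₂ : pull biprod.inr μ = δ₂ := by
    simp [μ, pull_add, ← pull_comp, zero_pull]
  exact ⟨H, hasConflation_of_pull hμ (isConflation_inl_snd _ _) (e₁ ▸ h₁),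
    hasConflation_of_pull hμ (isConflation_inr_fst _ _) (e₂ ▸ h₂)⟩

/-! ### Vanishing of extensions, and projective objects. -/

variable (C) in
/-- `ExtVanishes Z X`: every extension of `Z` by `X` is split. -/
def ExtVanishes (Z X : C) : Prop := ∀ δ : 𝔼 Z X, δ = 0

lemma HasConflation.iso_of_extVanishes {X Y Z : C} (h : HasConflation C X Y Z)
    (hZ : ExtVanishes C Z X) : Nonempty (Y ≅ X ⊞ Z) := by
  obtain ⟨x, y, δ, h⟩ := h
  rw [hZ δ, Extriangulated.s_zero] at h
  obtain ⟨b, -⟩ := seqClass_eq_iff.1 h.symm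
  exact ⟨b⟩

/-- Exactness of `C(X, W) ⟶ E(Z, W) ⟶ E(Y, W)`. -/
lemma exists_push_eq {X Y Z W : C} {x : X ⟶ Y} {y : Y ⟶ Z} {δ : 𝔼 Z X}
    (h : Extriangulated.s δ = seqClass x y) (ε : 𝔼 Z W) (hε : pull y ε = 0) :
    ∃ a : X ⟶ W, push a δ = ε := by
  obtain ⟨B, u, t, hB⟩ := exists_realization ε
  -- As `ε` pulls back to zero along `y`, the morphism `y` lifts through the deflation `t`; the lift
  -- induces `a` on first terms.
  obtain ⟨b, -, hb⟩ := Extriangulated.exists_lift (s_zero_left Y) hB 0 y (by simp [hε])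
  obtain ⟨a, ha, -⟩ := Extriangulated.et3_op h hB b (𝟙 Z) (by simpa using hb)
  exact ⟨a, by simpa using ha⟩

/-- This is exactness of $\mathbb E(Z,W)\to\mathbb E(Y,W)\to\mathbb E(X,W)$ in the middle: once `ε`
splits over `X`, a retraction onto `W` exhibits `ε` as pulled back from an extension of `Z`. -/
lemma ExtVanishes.of_conflation {X Y Z W : C} (h : HasConflation C X Y Z)
    (hX : ExtVanishes C X W) (hZ : ExtVanishes C Z W) : ExtVanishes C Y W := by
  intro ε
  obtain ⟨x, y, δ, h⟩ := h
  obtain ⟨B, t, p, hB⟩ := exists_realization ε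
  obtain ⟨N, d, e, h', δ'', -, -, -, h₂, -, h₃⟩ := Extriangulated.et4_op hB h
  rw [hX (pull x ε), Extriangulated.s_zero] at h₂
  obtain ⟨b, hb, -⟩ := seqClass_eq_iff.1 h₂.symm
  have hd : d ≫ b.hom ≫ biprod.fst = 𝟙 W := by simp [reassoc_of% hb]
  calc ε = push (d ≫ b.hom ≫ biprod.fst) ε := by rw [hd, push_id]
    _ = pull y (push (b.hom ≫ biprod.fst) δ'') := by
        rw [push_comp, h₃, push_pull]
    _ = 0 := by rw [hZ (push _ δ''), pull_map_zero]

lemma ExtVanishes.of_iso {Z Z' W : C} (h : ExtVanishes C Z W) (c : Z ≅ Z') :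
    ExtVanishes C Z' W := fun δ => by
  rw [← pull_id δ, ← c.inv_hom_id, pull_comp, h (pull c.hom δ), pull_map_zero]

lemma IsProj.extVanishes {P : C} (hP : IsProj P) (W : C) : ExtVanishes C P W := by
  intro δ
  obtain ⟨B, x, y, h⟩ := exists_realization δ
  obtain ⟨t, ht : t ≫ y = 𝟙 P⟩ := (hP x y ⟨δ, h⟩).2.2 (𝟙 P)
  rw [← pull_id δ, ← ht, pull_comp, pull_snd_eq_zero h, pull_map_zero]

lemma IsProj.biprod {P Q : C} (hP : IsProj P) (hQ : IsProj Q) : IsProj (P ⊞ Q) := by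
  intro X Y Z x y h
  obtain ⟨iP, eP, sP⟩ := hP x y h
  obtain ⟨iQ, eQ, sQ⟩ := hQ x y h
  refine ⟨fun a a' e => ?_, fun b => ⟨fun e => ?_, ?_⟩, fun c => ?_⟩
  · have e : a ≫ x = a' ≫ x := e
    apply biprod.hom_ext'
    · exact iP (by simp [e])
    · exact iQ (by simp [e])
  · have e : b ≫ y = 0 := e
    obtain ⟨p, hp : p ≫ x = _⟩ := (eP (biprod.inl ≫ b)).1 (by simp [e])
    obtain ⟨q, hq : q ≫ x = _⟩ := (eQ (biprod.inr ≫ b)).1 (by simp [e])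
    exact ⟨biprod.desc p q, by apply biprod.hom_ext' <;> simp [hp, hq]⟩
  · rintro ⟨a, rfl⟩
    apply biprod.hom_ext'
    · simpa using (eP ((biprod.inl ≫ a) ≫ x)).2 ⟨_, rfl⟩
    · simpa using (eQ ((biprod.inr ≫ a) ≫ x)).2 ⟨_, rfl⟩
  · obtain ⟨p, hp : p ≫ y = _⟩ := sP (biprod.inl ≫ c)
    obtain ⟨q, hq : q ≫ y = _⟩ := sQ (biprod.inr ≫ c)
    exact ⟨biprod.desc p q, by apply biprod.hom_ext' <;> simp [hp, hq]⟩

/-- A projective object is Gorenstein projective: it is a syzygy of the periodic complex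
`⋯ ⟶ P ⊞ P ⟶ P ⊞ P ⟶ ⋯` spliced from split conflations. -/
lemma IsProj.isGorensteinProjective {P : C} (hP : IsProj P) : IsGorensteinProjective P := by
  let X : ChainComplex C ℤ := ChainComplex.of (fun _ => P ⊞ P)
    (fun _ => (biprod.snd : P ⊞ P ⟶ P) ≫ (biprod.inl : P ⟶ P ⊞ P)) (by simp)
  let D : ExactDecomposition X :=
    { K := fun _ => P
      g := fun _ => (biprod.inl : P ⟶ P ⊞ P)
      f := fun _ => (biprod.snd : P ⊞ P ⟶ P)
      conflation := fun _ => isConflation_inl_snd P P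
      d_eq := fun n => by simp [X] }
  have hD : D.HomToExactFor IsProj := by
    intro W _ n
    refine ⟨fun (c c' : P ⟶ W) e => ?_, fun b => ⟨fun e => ?_, ?_⟩, fun c => ?_⟩
    · have e : (biprod.snd : P ⊞ P ⟶ P) ≫ c = biprod.snd ≫ c' := e
      simpa using congrArg (fun t => (biprod.inr : P ⟶ P ⊞ P) ≫ t) e
    · have e : (biprod.inl : P ⟶ P ⊞ P) ≫ b = 0 := e
      refine ⟨(biprod.inr : P ⟶ P ⊞ P) ≫ b, ?_⟩
      change (biprod.snd : P ⊞ P ⟶ P) ≫ biprod.inr ≫ b = b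
      apply biprod.hom_ext' <;> simp [e]
    · rintro ⟨c, rfl⟩
      change (biprod.inl : P ⟶ P ⊞ P) ≫ biprod.snd ≫ c = 0
      simp
    · refine ⟨(biprod.fst : P ⊞ P ⟶ P) ≫ c, ?_⟩
      change (biprod.inl : P ⟶ P ⊞ P) ≫ biprod.fst ≫ c = c
      simp
  exact ⟨X, ⟨fun _ => hP.biprod hP, ⟨D, hD⟩, D, fun W hW n => hW _ _ (D.conflation n)⟩,
    D, hD, 0, ⟨Iso.refl P⟩⟩

/-! ### The coresolving class containing the Gorenstein projectives. -/

variable (C) in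
/-- A class of objects without extensions by projective objects, each of which embeds in a
projective object with cokernel in the class. -/
def IsCoresolving (S : C → Prop) : Prop :=
  ∀ X, S X → (∀ W, IsProj W → ExtVanishes C X W) ∧
    ∃ P Y, IsProj P ∧ HasConflation C X P Y ∧ S Y

variable (C) in
/-- The largest coresolving class. -/
def InCoresolving (X : C) : Prop := ∃ S, IsCoresolving C S ∧ S X

lemma isCoresolving_inCoresolving : IsCoresolving C (InCoresolving C) := by
  rintro X ⟨S, hS, hX⟩
  obtain ⟨h, P, Y, hP, hc, hY⟩ := hS X hX
  exact ⟨h, P, Y, hP, hc, S, hS, hY⟩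

/-- Over the projective term every extension splits, so `ε` is a push-forward of the conflation
along some `a : K (n+1) ⟶ W`. As `a` extends along the inflation, this push-forward is zero. -/
lemma ExactDecomposition.extVanishes {P : ChainComplex C ℤ} (hP : ∀ n, IsProj (P.X n))
    (D : ExactDecomposition P) (hD : D.HomToExactFor IsProj) (n : ℤ) {W : C} (hW : IsProj W) :
    ExtVanishes C (D.K n) W := by
  intro ε
  obtain ⟨δ, hδ⟩ := D.conflation n
  obtain ⟨a, rfl⟩ := exists_push_eq hδ ε (IsProj.extVanishes (hP n) W _)
  obtain ⟨b, rfl⟩ := (hD W hW n).2.2 a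
  rw [push_comp, push_fst_eq_zero hδ, push_map_zero]

lemma IsGorensteinProjective.inCoresolving {G : C} (hG : IsGorensteinProjective G) :
    InCoresolving C G := by
  obtain ⟨P, ⟨hP, -, -⟩, D, hD, n, hn⟩ := hG
  -- All syzygies of the resolution together form a coresolving class, since `K n` embeds in the
  -- term of degree `n - 1` with cokernel `K (n - 1)`.
  refine ⟨fun X => ∃ n, Nonempty (D.K n ≅ X), ?_, n, hn⟩
  rintro X ⟨n, ⟨i⟩⟩
  refine ⟨fun W hW => (D.extVanishes hP hD n hW).of_iso i, P.X (n - 1), D.K (n - 1), hP _, ?_,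
    n - 1, ⟨Iso.refl _⟩⟩
  have h : HasConflation C (D.K (n - 1 + 1)) (P.X (n - 1)) (D.K (n - 1)) :=
    ⟨_, _, D.conflation (n - 1)⟩
  rw [sub_add_cancel] at h
  exact h.of_iso i (Iso.refl _) (Iso.refl _)

/-- By coinduction it suffices that the class of all such extensions is coresolving. This is one
step of a horseshoe construction. -/
lemma InCoresolving.of_conflation {G H G' : C} (h : HasConflation C G H G')
    (hG : InCoresolving C G) (hG' : InCoresolving C G') : InCoresolving C H := by
  refine ⟨fun H => ∃ G G', HasConflation C G H G' ∧ InCoresolving C G ∧ InCoresolving C G', ?_,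
    G, G', h, hG, hG'⟩
  rintro H ⟨G, G', h, hG, hG'⟩
  obtain ⟨v, P, Y, hP, hc, hY⟩ := isCoresolving_inCoresolving G hG
  obtain ⟨v', P', Y', hP', hc', hY'⟩ := isCoresolving_inCoresolving G' hG'
  refine ⟨fun W hW => .of_conflation h (v W hW) (v' W hW), ?_⟩
  obtain ⟨Q, h₁, h₂⟩ := h.pushout hc
  -- The push-out `Q` of `H` along `G ⟶ P` is an extension of `G'` by `P`, so it is `P ⊞ G'` and
  -- embeds in `P ⊞ P'`. The cokernel of `H` there is an extension of `Y'` by `Y`.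
  obtain ⟨b⟩ := h₂.iso_of_extVanishes (v' P hP)
  obtain ⟨N, hN, hN'⟩ :=
    h₁.octahedron ((hc'.biprod_map P).of_iso b.symm (Iso.refl _) (Iso.refl _))
  exact ⟨P ⊞ P', N, hP.biprod hP', hN, Y, Y', hN', hY, hY'⟩

/-! ### Syzygies, and the replacement of their terms by projectives. -/

/-- `IsSyzygy 𝒲 n N`: there is an exact complex `0 ⟶ N ⟶ G (n-1) ⟶ ⋯ ⟶ G 0 ⟶ M ⟶ 0`
with all `G i` in `𝒲`. -/
def IsSyzygy (𝒲 : C → Prop) : ℕ → C → Prop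
  | 0, _ => True
  | n + 1, N => ∃ G K, 𝒲 G ∧ HasConflation C N G K ∧ IsSyzygy 𝒲 n K

lemma IsSyzygy.mono {𝒲 𝒱 : C → Prop} (h : ∀ X, 𝒲 X → 𝒱 X) {n : ℕ} {N : C}
    (hN : IsSyzygy 𝒲 n N) : IsSyzygy 𝒱 n N := by
  induction n generalizing N with
  | zero => trivial
  | succ n ih =>
    obtain ⟨G, K, hG, hc, hK⟩ := hN
    exact ⟨G, K, h G hG, hc, ih hK⟩

lemma IsSyzygy.of_iso {𝒲 : C → Prop} {n : ℕ} {N N' : C} (hN : IsSyzygy 𝒲 n N) (i : N ≅ N') :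
    IsSyzygy 𝒲 n N' := by
  cases n with
  | zero => trivial
  | succ n =>
    obtain ⟨G, K, hG, hc, hK⟩ := hN
    exact ⟨G, K, hG, hc.of_iso i (Iso.refl _) (Iso.refl _), hK⟩

lemma IsSyzygy.exists_terms {𝒲 : C → Prop} {n : ℕ} {N : C} (hN : IsSyzygy 𝒲 n N) :
    ∃ K : ℕ → C, K n = N ∧ ∀ i < n, ∃ G, 𝒲 G ∧ HasConflation C (K (i + 1)) G (K i) := by
  induction n generalizing N with
  | zero => exact ⟨fun _ => N, rfl, by simp⟩
  | succ n ih =>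
    obtain ⟨G, L, hG, hc, hL⟩ := hN
    obtain ⟨K, rfl, hK⟩ := ih hL
    -- The recursion peels the complex off at `N`, which carries the highest index, so the new term
    -- goes to position `n + 1`.
    refine ⟨fun i => if i ≤ n then K i else N, by simp, fun i hi => ?_⟩
    rcases Nat.lt_succ_iff_lt_or_eq.1 hi with hi | rfl
    · simpa [hi.le, Nat.succ_le_of_lt hi] using hK i hi
    · exact ⟨G, hG, by simpa using hc⟩

open ZeroObject in
lemma isGorensteinSyzygy_iff {n : ℕ} {N : C} :
    IsGorensteinSyzygy n N ↔ IsSyzygy IsGorensteinProjective n N := by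
  constructor
  · rintro ⟨M, X, hX⟩
    have key : ∀ i ≤ n, IsSyzygy IsGorensteinProjective i (X.K i) := by
      intro i
      induction i with
      | zero => intro _; trivial
      | succ i ih =>
        intro hi
        exact ⟨X.G i, X.K i, hX i hi, ⟨_, _, X.conflation i hi⟩, ih (Nat.le_of_succ_le hi)⟩
    exact (key n le_rfl).of_iso X.isoLeft
  · intro h
    obtain ⟨K, hn, hK⟩ := h.exists_terms
    have : ∀ i, ∃ (G : C) (g : K (i + 1) ⟶ G) (f : G ⟶ K i),
        i < n → IsConflation g f ∧ IsGorensteinProjective G := by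
      intro i
      by_cases hi : i < n
      · obtain ⟨G, hG, g, f, h⟩ := hK i hi
        exact ⟨G, g, f, fun _ => ⟨h, hG⟩⟩
      · exact ⟨0, 0, 0, fun h => absurd h hi⟩
    choose G g f h using this
    exact ⟨K 0, ⟨G, K, g, f, fun i hi => (h i hi).1, Iso.refl _, eqToIso hn⟩,
      fun i hi => (h i hi).2⟩

/-- The terms of a syzygy complex in a coresolving class can be replaced by projective
objects. -/
lemma IsSyzygy.isProj {n : ℕ} {N : C} (hN : IsSyzygy (InCoresolving C) n N) :
    IsSyzygy (C := C) IsProj n N := by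
  induction n generalizing N with
  | zero => trivial
  | succ n ih =>
    obtain ⟨G, K, hG, hc, hK⟩ := hN
    obtain ⟨-, P, G', hP, hGP, hG'⟩ := isCoresolving_inCoresolving G hG
    obtain ⟨L, hL, hKL⟩ := hc.octahedron hGP
    refine ⟨P, L, hP, hL, ih ?_⟩
    -- `L` must be a syzygy for the remaining length. If that is zero, `L` is the new right end;
    -- otherwise `K` has a next term along which to push out.
    cases n with
    | zero => trivial
    | succ m =>
      obtain ⟨G₀, K', hG₀, hc₀, hK'⟩ := hK
      obtain ⟨H, h₁, h₂⟩ := hKL.pushout hc₀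
      exact ⟨H, K', .of_conflation h₂ hG₀ hG', h₁, hK'⟩

/-- Gorenstein syzygy objects are the syzygy objects of complexes of projective objects. -/
lemma isGorensteinSyzygy_iff_isProj {n : ℕ} {N : C} :
    IsGorensteinSyzygy n N ↔ IsSyzygy (C := C) IsProj n N := by
  rw [isGorensteinSyzygy_iff]
  exact ⟨fun h => (h.mono fun _ => IsGorensteinProjective.inCoresolving).isProj,
    fun h => h.mono fun _ => IsProj.isGorensteinProjective⟩

end Structure

/-! ### Transport along exact functors with exact right adjoints. -/

section Functors

variable {C : Type u₁} [Category.{v₁} C] [Preadditive C] [HasZeroObject C] [HasBinaryBiproducts C]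
  [Extriangulated.{w₁} C]
  {D : Type u₂} [Category.{v₂} D] [Preadditive D] [HasZeroObject D] [HasBinaryBiproducts D]
  [Extriangulated.{w₂} D]

/-- A left adjoint of an exact functor preserves projective objects. -/
lemma IsProj.map_of_adjunction {F : C ⥤ D} {G : D ⥤ C} (adj : F ⊣ G) (hG : IsExactFunctor G)
    {P : C} (hP : IsProj P) : IsProj (F.obj P) := by
  intro X Y Z x y h
  have := hG.additive
  obtain ⟨hi, he, hs⟩ := hP _ _ (hG.map_conflation x y h)
  -- Exactness in the middle involves zero morphisms, so the adjunction bijection must respect them;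
  -- additivity of `G` ensures this.
  have hz : ∀ {T : D} (b : F.obj P ⟶ T), adj.homEquiv P T b = 0 ↔ b = 0 := by
    intro T b
    have h0 : adj.homEquiv P T 0 = 0 := by simp [Adjunction.homEquiv_unit]
    rw [← h0, Equiv.apply_eq_iff_eq]
  refine ⟨fun a a' e => ?_, fun b => ?_, fun c => ?_⟩
  · have e : a ≫ x = a' ≫ x := e
    apply (adj.homEquiv _ _).injective
    apply hi
    simp only [← Adjunction.homEquiv_naturality_right, e]
  · have key := he (adj.homEquiv _ _ b)
    simp only [← Adjunction.homEquiv_naturality_right, hz] at key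
    rw [key]
    constructor
    · rintro ⟨a, ha⟩
      refine ⟨(adj.homEquiv _ _).symm a, (adj.homEquiv _ _).injective ?_⟩
      simpa [Adjunction.homEquiv_naturality_right] using ha
    · rintro ⟨a, rfl⟩
      exact ⟨adj.homEquiv _ _ a, (Adjunction.homEquiv_naturality_right _ _ _).symm⟩
  · obtain ⟨b, hb⟩ := hs (adj.homEquiv _ _ c)
    refine ⟨(adj.homEquiv _ _).symm b, (adj.homEquiv _ _).injective ?_⟩
    simpa [Adjunction.homEquiv_naturality_right] using hb

lemma IsSyzygy.map {F : C ⥤ D} (hF : IsExactFunctor F) {𝒲 : C → Prop} {𝒱 : D → Prop}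
    (h : ∀ X, 𝒲 X → 𝒱 (F.obj X)) {n : ℕ} {N : C} (hN : IsSyzygy 𝒲 n N) :
    IsSyzygy 𝒱 n (F.obj N) := by
  induction n generalizing N with
  | zero => trivial
  | succ n ih =>
    obtain ⟨G, K, hG, ⟨x, y, hc⟩, hK⟩ := hN
    exact ⟨F.obj G, F.obj K, h G hG, ⟨_, _, hF.map_conflation x y hc⟩, ih hK⟩

/-- An exact functor with an exact right adjoint preserves Gorenstein syzygy objects. -/
lemma IsGorensteinSyzygy.map {F : C ⥤ D} {G : D ⥤ C} (adj : F ⊣ G) (hF : IsExactFunctor F)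
    (hG : IsExactFunctor G) {n : ℕ} {N : C} (hN : IsGorensteinSyzygy n N) :
    IsGorensteinSyzygy n (F.obj N) := by
  rw [isGorensteinSyzygy_iff_isProj] at hN ⊢
  exact hN.map hF fun _ hP => hP.map_of_adjunction adj hG

end Functors

end Extri

theorem theorem4p7
    {A' : Type u₁} [Category.{v₁} A'] [Preadditive A'] [HasZeroObject A'] [HasBinaryBiproducts A']
    [Extri.Extriangulated.{w₁} A']
    {A : Type u₂} [Category.{v₂} A] [Preadditive A] [HasZeroObject A] [HasBinaryBiproducts A]
    [Extri.Extriangulated.{w₂} A]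
    {A'' : Type u₃} [Category.{v₃} A''] [Preadditive A''] [HasZeroObject A''] [HasBinaryBiproducts A'']
    [Extri.Extriangulated.{w₃} A'']
    (R : Extri.Recollement A' A A'') (n : ℕ) (hn : 0 < n) :
    (Extri.IsExactFunctor R.jLowerStar →
      ∀ X : A, Extri.IsGorensteinSyzygy n X →
        Extri.IsGorensteinSyzygy n (R.jUpperStar.obj X)) ∧
    (Extri.IsExactFunctor R.iUpperStar →
      ∀ X : A, Extri.IsGorensteinSyzygy n X →
        Extri.IsGorensteinSyzygy n (R.iUpperStar.obj X)) ∧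
    (Extri.IsExactFunctor R.iUpperShriek → Extri.IsExactFunctor R.iUpperStar →
      R.iUpperStar.Faithful →
      ∀ X' : A', Extri.IsGorensteinSyzygy n X' →
        Extri.IsGorensteinSyzygy n (R.iLowerStar.obj X')) ∧
    (Extri.IsExactFunctor R.jLowerShriek → Extri.IsExactFunctor R.jLowerStar →
      ∀ X'' : A'', Extri.IsGorensteinSyzygy n X'' →
        Extri.IsGorensteinSyzygy n (R.jLowerShriek.obj X'')) :=
  ⟨fun h _ hX => hX.map R.jAdj₂ R.jUpperStar_exact h,
    fun h _ hX => hX.map R.iAdj₁ h R.iLowerStar_exact,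
    fun h _ _ _ hX => hX.map R.iAdj₂ R.iLowerStar_exact h,
    fun h _ _ hX => hX.map R.jAdj₁ h R.jUpperStar_exact⟩
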